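/- Let $G$ be a finite connected graph. Burning proceeds in steps: at step $1$ one vertex is set on fire; at every step $i\ge 2$, all neighbours of the vertices on fire catch fire and, in addition, one new vertex (not on fire at the end of step $i-1$) is set on fire. The burning number $b(G)$ is the least $k$ such that the process can be played so that all vertices of $G$ are on fire at the end of step $k$. The growth of $G$ is the smallest $k$ such that, for some path $P$ in $G$, every vertex of $G$ is within distance $k$ of $P$. Theorem. For every integer $k\ge 0$ there is an integer $N$, depending only on $k$, such that every finite tree $T$ of growth at most $k$ on $n\ge N$ vertices satisfies $$b(T)\le \lceil\sqrt n\,\rceil+1 .$$ -/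

import Mathlib

namespace GraphBurning

universe u

variable {V : Type u}

/-- `FireAfter G k F`: the burning process on `G` can be played so that `F` is exactly the set of
vertices on fire at the end of step `k`. Nothing is on fire before step `1`. In each step, all
neighbours of the vertices on fire catch fire, and one new vertex `v` (a vertex that was not on
fire at the end of the previous step) is set on fire. -/
inductive FireAfter (G : SimpleGraph V) : ℕ → Set V → Prop
  | zero : FireAfter G 0 ∅
  | step {k : ℕ} {F : Set V} (h : FireAfter G k F) (v : V) (hv : v ∉ F) :
      FireAfter G (k + 1) (F ∪ {w | ∃ u ∈ F, G.Adj u w} ∪ {v})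

/-- `G` is `k`-burnable if the process can be played so that the whole graph is on fire at the end
of step `k`. -/
def Burnable (G : SimpleGraph V) (k : ℕ) : Prop :=
  FireAfter G k Set.univ

/-- The burning number `b(G)`: the least `k` such that `G` is `k`-burnable. -/
noncomputable def burningNumber (G : SimpleGraph V) : ℕ :=
  sInf {k | Burnable G k}

/-- Every vertex of `G` is within distance `k` of some path of `G`. -/
def HasSpine (G : SimpleGraph V) (k : ℕ) : Prop :=
  ∃ (a b : V) (P : G.Walk a b), P.IsPath ∧ ∀ x : V, ∃ y ∈ P.support, G.edist x y ≤ (k : ℕ∞)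

/-- The growth of a (connected) graph `G`: the smallest `k` such that all vertices of `G` are
within distance `k` of some path of `G`. -/
noncomputable def growth (G : SimpleGraph V) : ℕ :=
  sInf {k | HasSpine G k}

/-- On a finite graph the burning number is a minimum over a nonempty set. -/
theorem exists_burnable [Finite V] (G : SimpleGraph V) : ∃ k, Burnable G k := by
  by_contra! hno
  have key : ∀ k : ℕ, ∃ F : Set V, FireAfter G k F ∧ k ≤ F.ncard := by
    intro k
    induction k with
    | zero => exact ⟨∅, FireAfter.zero, Nat.zero_le _⟩
    | succ k ih =>
      obtain ⟨F, hF, hk⟩ := ih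
      have hne : F ≠ Set.univ := by
        rintro rfl
        exact hno k hF
      obtain ⟨v, hv⟩ := (Set.ne_univ_iff_exists_notMem F).1 hne
      refine ⟨_, FireAfter.step hF v hv, ?_⟩
      have hlt : F.ncard < (F ∪ {w | ∃ u ∈ F, G.Adj u w} ∪ {v}).ncard := by
        apply Set.ncard_lt_ncard _ (Set.toFinite _)
        refine ⟨fun x hx => Or.inl (Or.inl hx), fun h => hv (h (Or.inr rfl))⟩
      omega
  obtain ⟨F, -, hF⟩ := key (Nat.card V + 1)
  have := Set.ncard_le_card F
  omega

/-- On a finite connected graph the growth is a minimum over a nonempty set. -/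
theorem exists_hasSpine [Finite V] (G : SimpleGraph V) (hG : G.Connected) :
    ∃ k, HasSpine G k := by
  classical
  obtain ⟨a⟩ := hG.nonempty
  have := Fintype.ofFinite V
  refine ⟨Finset.univ.sup fun x => G.dist x a, a, a, SimpleGraph.Walk.nil,
    SimpleGraph.Walk.IsPath.nil, fun x => ⟨a, by simp, ?_⟩⟩
  rw [← (hG x a).coe_dist_eq_edist]
  exact_mod_cast Finset.le_sup (f := fun x => G.dist x a) (Finset.mem_univ x)

end GraphBurning

namespace GraphBurning

/-! Burning in `m` steps amounts to covering by balls of radii `0, …, m - 1`. Put `m = ⌈√n⌉ + 1`. On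
a spine of `l` vertices the balls have total length `m ^ 2`, and if `B` is the set of positions
where something is attached, then `l + B.card ≤ n ≤ (m - 1) ^ 2`, so `B.card + 2 * m - 1` is
available for losses. Shortening a ball by `k` at both ends makes it cover all attachments, at a
loss of `2 * k`.

If `B` is large, it pays for shortening every ball (`coverable_of_short`). Otherwise few cuts
between consecutive positions are bad, that is, too near an attachment. A full ball between two good
cuts loses nothing. The greedy choice in `coverable_of_few_bad_cuts` fails only when every remaining
radius leads to a bad cut; the largest ball then passes many bad cuts, so this happens a number of
times bounded in terms of `k`. The last few balls are all shortened, losing at most about `m / 2`.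
-/

/-- If balls of radii `0, …, m - 1` cover the graph, it can be burned in at most `m` steps. -/
theorem burningNumber_le_of_cover {V : Type*} (G : SimpleGraph V) (m : ℕ) (f : ℕ → V)
    (hf : ∀ x, ∃ r < m, ∃ p : G.Walk (f r) x, p.length ≤ r) : burningNumber G ≤ m := by
  suffices h : ∃ k ≤ m, Burnable G k by
    obtain ⟨k, hk, hb⟩ := h
    exact (Nat.sInf_le hb).trans hk
  by_contra! hno
  have key : ∀ j ≤ m, ∃ F : Set V, FireAfter G j F ∧
      ∀ i < j, ∀ x, (∃ p : G.Walk (f (m - 1 - i)) x, p.length + i + 1 ≤ j) → x ∈ F := by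
    intro j
    induction j with
    | zero => exact fun _ => ⟨∅, FireAfter.zero, fun i hi => absurd hi (by omega)⟩
    | succ j ih =>
      intro hj
      obtain ⟨F, hF, hcov⟩ := ih (by omega)
      have hne : F ≠ Set.univ := by
        rintro rfl
        exact hno j (by omega) hF
      -- The ball of radius `m - 1 - j` is lit at step `j + 1`, leaving that many steps to spread.
      -- If its centre already burns, any unburnt vertex is a legal move.
      obtain ⟨v, hv, hfv⟩ : ∃ v, v ∉ F ∧ (f (m - 1 - j) ∈ F ∨ f (m - 1 - j) = v) := by
        by_cases h : f (m - 1 - j) ∈ F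
        · obtain ⟨v, hv⟩ := (Set.ne_univ_iff_exists_notMem F).1 hne
          exact ⟨v, hv, Or.inl h⟩
        · exact ⟨_, h, Or.inr rfl⟩
      refine ⟨_, FireAfter.step hF v hv, ?_⟩
      rintro i hi x ⟨p, hp⟩
      rcases Nat.lt_succ_iff_lt_or_eq.1 hi with hij | rfl
      · generalize hq : p.reverse = q
        have hlen : q.length = p.length := by rw [← hq, SimpleGraph.Walk.length_reverse]
        cases q with
        | nil =>
          refine Or.inl (Or.inl (hcov i hij _ ⟨SimpleGraph.Walk.nil, ?_⟩))
          simpa using hij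
        | cons h q =>
          rw [SimpleGraph.Walk.length_cons] at hlen
          refine Or.inl (Or.inr ⟨_, hcov i hij _ ⟨q.reverse, ?_⟩, h.symm⟩)
          rw [SimpleGraph.Walk.length_reverse]
          omega
      · have hx := SimpleGraph.Walk.eq_of_length_eq_zero (p := p) (by omega)
        rw [← hx]
        rcases hfv with h | h
        · exact Or.inl (Or.inl h)
        · exact Or.inr h
  obtain ⟨F, hF, hcov⟩ := key m le_rfl
  refine hno m le_rfl ?_
  have hF' : F = Set.univ := by
    refine Set.eq_univ_of_forall fun x => ?_
    obtain ⟨r, hr, p, hp⟩ := hf x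
    have hr' : m - 1 - (m - 1 - r) = r := by omega
    refine hcov (m - 1 - r) (by omega) x ?_
    rw [hr']
    exact ⟨p, by omega⟩
  rwa [hF'] at hF

/-! ### Covering the spine by intervals -/

/-- The ball of radius `r` around position `c` of the spine reaches everything of depth at most `k`
that is attached at position `i`, where something is attached only at the positions in `B`. -/
def Reaches (B : Finset ℕ) (k c r i : ℕ) : Prop :=
  i ≤ c + r ∧ c ≤ i + r ∧ (i ∈ B → i + k ≤ c + r ∧ c + k ≤ i + r)

/-- The spine positions in `[x, l)`, with everything attached to them, can be covered by balls with
radii in `R`. -/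
def Coverable (B : Finset ℕ) (k l : ℕ) (R : Finset ℕ) (x : ℕ) : Prop :=
  ∃ f : ℕ → ℕ, ∀ i, x ≤ i → i < l → ∃ r ∈ R, Reaches B k (f r) r i

theorem Coverable.of_erase {B R : Finset ℕ} {k l x y c r : ℕ} (hr : r ∈ R)
    (hc : ∀ i, x ≤ i → i < y → Reaches B k c r i) (h : Coverable B k l (R.erase r) y) :
    Coverable B k l R x := by
  obtain ⟨f, hf⟩ := h
  refine ⟨Function.update f r c, fun i hxi hil => ?_⟩
  by_cases hy : i < y
  · exact ⟨r, hr, by simpa using hc i hxi hy⟩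
  · obtain ⟨q, hq, hqi⟩ := hf i (by omega) hil
    rw [Finset.mem_erase] at hq
    exact ⟨q, hq.2, by rwa [Function.update_of_ne hq.1]⟩

theorem reaches_of_short {B : Finset ℕ} {k x r i : ℕ} (hk : k ≤ r) (hx : x ≤ i)
    (hi : i < x + 2 * (r - k) + 1) : Reaches B k (x + (r - k)) r i :=
  ⟨by omega, by omega, fun _ => ⟨by omega, by omega⟩⟩

/-- Good cuts keep every attachment between them at least `k` inside the interval, so no shortening
is needed. -/
theorem reaches_of_good_ends {B : Finset ℕ} {k x r i : ℕ}
    (hgx : ∀ j ∈ B, j + k < x ∨ x + k ≤ j)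
    (hge : ∀ j ∈ B, j + k < x + 2 * r + 1 ∨ x + 2 * r + 1 + k ≤ j) (hx : x ≤ i)
    (hi : i < x + 2 * r + 1) : Reaches B k (x + r) r i := by
  refine ⟨by omega, by omega, fun hB => ?_⟩
  have h1 := hgx i hB
  have h2 := hge i hB
  omega

/-- Balls shortened by `k` on both sides cover the spine with everything attached to it. -/
theorem coverable_of_short {B : Finset ℕ} {k l : ℕ} (R : Finset ℕ) (x : ℕ) (hR : ∀ r ∈ R, k ≤ r)
    (h : l + 2 * k * R.card ≤ x + ∑ r ∈ R, (2 * r + 1)) : Coverable B k l R x := by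
  induction R using Finset.induction_on generalizing x with
  | empty => exact ⟨id, fun i h1 h2 => by simp at h; omega⟩
  | insert r R hr ih =>
    rw [Finset.card_insert_of_notMem hr, Finset.sum_insert hr, mul_add, mul_one] at h
    have hk := hR r (Finset.mem_insert_self r R)
    refine Coverable.of_erase (y := x + 2 * (r - k) + 1) (Finset.mem_insert_self r R)
      (fun i => reaches_of_short hk) ?_
    rw [Finset.erase_insert hr]
    exact ih _ (fun q hq => hR q (Finset.mem_insert_of_mem hq)) (by omega)

/-- If all cuts in a large set of candidates after `x` are bad, then moving to the farthest
candidate passes many bad cuts. -/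
theorem card_bad_after_le {D R : Finset ℕ} {k x y r b t F : ℕ} (hk : ∀ q ∈ R, k ≤ q)
    (hmax : ∀ q ∈ R, q ≤ r) (hb : b ≤ 2 * k) (hy : y = x + 2 * (r - k) + 1) (hr : r ∈ R)
    (hcard : t + 2 * k < R.card) (hbad : ∀ q ∈ R, x + (2 * q - b) + 1 ∈ D)
    (hF : (D.filter (x < ·)).card ≤ F * t) (ht : 0 < t) :
    ∃ E, F = E + 1 ∧ (D.filter (y < ·)).card ≤ E * t := by
  have hkr := hk r hr
  -- Only the `2 * k` positions just after `y` can hold candidates that are not passed.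
  have h1 : R.image (fun q => x + (2 * q - b) + 1) ⊆
      (D.filter fun e => x < e ∧ e ≤ y) ∪ Finset.Ioc y (y + 2 * k) := by
    intro e he
    obtain ⟨q, hq, rfl⟩ := Finset.mem_image.1 he
    have h2 := hbad q hq
    have h3 := hmax q hq
    have h4 := hk q hq
    simp only [Finset.mem_union, Finset.mem_filter, Finset.mem_Ioc, h2, true_and]
    omega
  have h2 : (R.image (fun q => x + (2 * q - b) + 1)).card = R.card := by
    refine Finset.card_image_of_injOn fun p hp q hq hpq => ?_
    have h4 := hk q hq
    have h5 := hk p hp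
    have hpq : x + (2 * p - b) + 1 = x + (2 * q - b) + 1 := hpq
    omega
  have h3 := (Finset.card_le_card h1).trans (Finset.card_union_le _ _)
  rw [h2, Nat.card_Ioc] at h3
  have h4 : (D.filter fun e => x < e ∧ e ≤ y).card + (D.filter (y < ·)).card
      ≤ (D.filter (x < ·)).card := by
    rw [← Finset.card_union_of_disjoint]
    · refine Finset.card_le_card fun e => ?_
      simp only [Finset.mem_union, Finset.mem_filter]
      rintro (h | h)
      · exact ⟨h.1, h.2.1⟩
      · exact ⟨h.1, by omega⟩
    · refine Finset.disjoint_left.2 fun e h h' => ?_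
      simp only [Finset.mem_filter] at h h'
      omega
  cases F with
  | zero => omega
  | succ E =>
    rw [add_mul, one_mul] at hF
    exact ⟨E, rfl, by omega⟩

/-- Greedy covering: always end the next ball at a good cut if possible, and otherwise use the
largest remaining ball. -/
theorem coverable_of_few_bad_cuts {B D : Finset ℕ} {k l t : ℕ} (ht : 0 < t)
    (hD : ∀ e, e ∉ D → ∀ j ∈ B, j + k < e ∨ e + k ≤ j) (R : Finset ℕ) (x F : ℕ)
    (hR : ∀ r ∈ R, k ≤ r) (hF : (D.filter (x < ·)).card ≤ F * t)
    (h : l + 2 * k * (t + 2 * k) + 4 * k * F + (if x ∈ D then 2 * k else 0) ≤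
      x + ∑ r ∈ R, (2 * r + 1)) : Coverable B k l R x := by
  induction R using Finset.strongInduction generalizing x F with
  | H R ih =>
  by_cases hs : R.card ≤ t + 2 * k
  · refine coverable_of_short R x hR ?_
    have := Nat.mul_le_mul_left (2 * k) hs
    omega
  have hne : R.Nonempty := Finset.card_pos.1 (by omega)
  -- From a bad cut the next ball must be shortened; this loss is already reserved in `h`.
  set b := if x ∈ D then 2 * k else 0 with hb
  have hb2 : b ≤ 2 * k := by rw [hb]; split_ifs <;> omega
  have hmono : ∀ y, x ≤ y → (D.filter (y < ·)).card ≤ F * t := fun y hy =>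
    (Finset.card_le_card fun e he => by
      rw [Finset.mem_filter] at he ⊢
      exact ⟨he.1, by omega⟩).trans hF
  have herase : ∀ r ∈ R, ∀ q ∈ R.erase r, k ≤ q := fun r _ q hq => hR q (Finset.mem_of_mem_erase hq)
  by_cases hgood : ∃ r ∈ R, x + (2 * r - b) + 1 ∉ D
  · obtain ⟨r, hr, hrD⟩ := hgood
    have hk := hR r hr
    have hsum := Finset.add_sum_erase R (fun r => 2 * r + 1) hr
    have hrec : Coverable B k l (R.erase r) (x + (2 * r - b) + 1) := by
      refine ih _ (Finset.erase_ssubset hr) _ F (herase r hr) (hmono _ (by omega)) ?_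
      rw [if_neg hrD]
      omega
    by_cases hx : x ∈ D
    · rw [if_pos hx] at hb
      exact hrec.of_erase hr fun i h1 h2 => reaches_of_short hk h1 (by omega)
    · rw [if_neg hx] at hb
      rw [hb, Nat.sub_zero] at hrD hrec
      exact hrec.of_erase hr fun i h1 h2 => reaches_of_good_ends (hD _ hx) (hD _ hrD) h1 h2
  · push Not at hgood
    have hr := R.max'_mem hne
    set r := R.max' hne
    have hk := hR r hr
    have hsum := Finset.add_sum_erase R (fun r => 2 * r + 1) hr
    obtain ⟨E, rfl, hE⟩ := card_bad_after_le hR (fun q hq => R.le_max' q hq) hb2 rfl hr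
      (by omega) hgood hF ht
    -- One unit of `F` releases `4 * k`: `2 * k` for shortening this ball and `2 * k` reserved in
    -- case `y` is bad.
    refine Coverable.of_erase hr (fun i => reaches_of_short hk)
      (ih _ (Finset.erase_ssubset hr) _ E (herase r hr) hE ?_)
    rw [mul_add (4 * k), mul_one] at h
    split_ifs <;> omega

/-- Discarding the radii below `k`, which cannot be shortened by `k`, costs only `k ^ 2`. -/
theorem sum_odd_Ico {k m : ℕ} (h : k ≤ m) : ∑ r ∈ Finset.Ico k m, (2 * r + 1) + k ^ 2 = m ^ 2 := by
  induction m, h using Nat.le_induction with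
  | base => simp
  | succ m hm ih => rw [Finset.sum_Ico_succ_top hm]; linarith

/-- A spine with few vertices, counted together with the attachments, is coverable by balls of all
radii below `m`. -/
theorem coverable_range {B : Finset ℕ} {k l m : ℕ} (hm : 1000 * (k + 1) ^ 4 ≤ m)
    (hl : l + B.card + 2 * m ≤ m ^ 2 + 1) : Coverable B k l (Finset.Ico k m) 0 := by
  have hkm : k ≤ m := by nlinarith [Nat.zero_le (k ^ 2), Nat.zero_le (k ^ 3), Nat.zero_le (k ^ 4)]
  have hsum := sum_odd_Ico hkm
  have hR : ∀ r ∈ Finset.Ico k m, k ≤ r := fun r hr => (Finset.mem_Ico.1 hr).1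
  by_cases hB : 2 * k * m ≤ B.card
  · refine coverable_of_short _ _ hR ?_
    rw [Nat.card_Ico]
    have h1 : 2 * k * (m - k) + 2 * k ^ 2 = 2 * k * m := by
      rw [show 2 * k ^ 2 = 2 * k * k by ring, ← mul_add, Nat.sub_add_cancel hkm]
    have h2 : 1 ≤ (k + 1) ^ 4 := Nat.one_le_pow _ _ (by omega)
    omega
  · push Not at hB
    set D := B.biUnion fun i => Finset.Ico (i + 1 - k) (i + k + 1) with hDdef
    have hDcard : D.card ≤ B.card * (2 * k) :=
      Finset.card_biUnion_le_card_mul _ _ _ fun i _ => by rw [Nat.card_Ico]; omega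
    have hD : ∀ e, e ∉ D → ∀ j ∈ B, j + k < e ∨ e + k ≤ j := by
      intro e he j hj
      by_contra hcon
      refine he (Finset.mem_biUnion.2 ⟨j, hj, ?_⟩)
      rw [Finset.mem_Ico]
      omega
    have hm1 : 4 * (k + 1) ≤ m := by
      nlinarith [Nat.zero_le (k ^ 2), Nat.zero_le (k ^ 3), Nat.zero_le (k ^ 4)]
    -- With this `t`, the final loss `2 * k * t` is at most `m / 2`, while `t` stays proportional to
    -- `m`, so the number `F` of greedy failures depends on `k` alone.
    have ht : 0 < m / (4 * (k + 1)) := Nat.div_pos hm1 (by omega)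
    have ht1 := Nat.div_mul_le_self m (4 * (k + 1))
    have ht2 : m < 4 * (k + 1) * (m / (4 * (k + 1)) + 1) := Nat.lt_mul_div_succ m (by omega)
    generalize m / (4 * (k + 1)) = t at ht ht1 ht2
    have ht3 : m ≤ 8 * (k + 1) * t := by
      have := Nat.mul_le_mul_left (4 * (k + 1)) (show t + 1 ≤ 2 * t by omega)
      linarith
    refine coverable_of_few_bad_cuts (F := 32 * k ^ 2 * (k + 1)) ht hD _ _ hR ?_ ?_
    · calc (D.filter (0 < ·)).card ≤ D.card := Finset.card_filter_le _ _
        _ ≤ B.card * (2 * k) := hDcard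
        _ ≤ 2 * k * m * (2 * k) := Nat.mul_le_mul_right _ hB.le
        _ = 4 * k ^ 2 * m := by ring
        _ ≤ 4 * k ^ 2 * (8 * (k + 1) * t) := Nat.mul_le_mul_left _ ht3
        _ = 32 * k ^ 2 * (k + 1) * t := by ring
    · have h1 : (if 0 ∈ D then 2 * k else 0) ≤ 2 * k := by split_ifs <;> omega
      nlinarith [Nat.zero_le (k ^ 2), Nat.zero_le (k ^ 3), Nat.zero_le (k ^ 4)]

/-! ### From the spine to the graph -/

/-- Indices past the end of `P` are allowed, since `getVert` then stays at `b`; ball centres may lie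
there. -/
theorem exists_walk_getVert {V : Type*} {G : SimpleGraph V} {a b : V} (P : G.Walk a b) {i j : ℕ}
    (h : i ≤ j) : ∃ p : G.Walk (P.getVert i) (P.getVert j), p.length ≤ j - i := by
  have hp : ((P.drop i).take (j - i)).length ≤ j - i := by
    rw [SimpleGraph.Walk.take_length]
    exact min_le_left _ _
  have he : (P.drop i).getVert (j - i) = P.getVert j := by
    rw [SimpleGraph.Walk.drop_getVert, Nat.add_sub_cancel' h]
  rw [← he]
  exact ⟨_, hp⟩

/-- Every vertex can be attached to a spine vertex, the spine vertices to themselves. -/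
theorem exists_attachment {V : Type*} {G : SimpleGraph V} {k : ℕ} {a b : V} (P : G.Walk a b)
    (hP : ∀ x : V, ∃ y ∈ P.support, G.edist x y ≤ (k : ℕ∞)) (x : V) :
    ∃ i ≤ P.length, ∃ p : G.Walk (P.getVert i) x,
      p.length ≤ k ∧ (x ∈ P.support → p.length = 0) := by
  by_cases hx : x ∈ P.support
  · obtain ⟨i, rfl, hi⟩ := SimpleGraph.Walk.mem_support_iff_exists_getVert.1 hx
    exact ⟨i, hi, SimpleGraph.Walk.nil, by simp, by simp⟩
  · obtain ⟨y, hy, hxy⟩ := hP x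
    obtain ⟨i, rfl, hi⟩ := SimpleGraph.Walk.mem_support_iff_exists_getVert.1 hy
    have hne : G.edist x (P.getVert i) ≠ ⊤ := (hxy.trans_lt (ENat.natCast_lt_top k)).ne
    obtain ⟨p, hp⟩ := SimpleGraph.exists_walk_of_edist_ne_top hne
    refine ⟨i, hi, p.reverse, ?_, fun h => absurd h hx⟩
    rw [SimpleGraph.Walk.length_reverse]
    exact_mod_cast hp.trans_le hxy

theorem burningNumber_le_of_hasSpine {V : Type*} [Fintype V] {G : SimpleGraph V} {k m : ℕ}
    (hG : HasSpine G k) (hm : 1000 * (k + 1) ^ 4 ≤ m)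
    (hV : Fintype.card V + 2 * m ≤ m ^ 2 + 1) : burningNumber G ≤ m := by
  classical
  obtain ⟨a, b, P, hP, hcov⟩ := hG
  choose i hi p hpk hp0 using exists_attachment P hcov
  set B := (Finset.univ.filter (· ∉ P.support)).image i with hB
  -- Each position in `B` is the image of some vertex off the path.
  have hcard : P.length + 1 + B.card ≤ Fintype.card V := by
    have h1 : B.card ≤ _ := Finset.card_image_le
    have h2 := Finset.card_filter_add_card_filter_not (s := Finset.univ) (· ∈ P.support)
    have h3 : Finset.univ.filter (· ∈ P.support) = P.support.toFinset := by ext; simp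
    rw [h3, List.toFinset_card_of_nodup hP.support_nodup, SimpleGraph.Walk.length_support,
      Finset.card_univ] at h2
    omega
  obtain ⟨c, hc⟩ := coverable_range (B := B) (l := P.length + 1) hm (by omega)
  refine burningNumber_le_of_cover G m (fun r => P.getVert (c r)) fun x => ?_
  obtain ⟨r, hr, h1, h2, h3⟩ := hc (i x) (Nat.zero_le _) (Nat.lt_succ_of_le (hi x))
  refine ⟨r, (Finset.mem_Ico.1 hr).2, ?_⟩
  obtain ⟨q, hq⟩ : ∃ q : G.Walk (P.getVert (c r)) (P.getVert (i x)),
      q.length ≤ (c r - i x) + (i x - c r) := by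
    rcases le_total (c r) (i x) with h | h
    · obtain ⟨q, hq⟩ := exists_walk_getVert P h
      exact ⟨q, by omega⟩
    · obtain ⟨q, hq⟩ := exists_walk_getVert P h
      exact ⟨q.reverse, by rw [SimpleGraph.Walk.length_reverse]; omega⟩
  refine ⟨q.append (p x), ?_⟩
  rw [SimpleGraph.Walk.length_append]
  by_cases hx : x ∈ P.support
  · have := hp0 x hx
    omega
  · have h4 := h3 (Finset.mem_image_of_mem i (by simpa using hx))
    have := hpk x
    omega

theorem HasSpine.mono {V : Type*} {G : SimpleGraph V} {k l : ℕ} (h : HasSpine G k) (hkl : k ≤ l) :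
    HasSpine G l := by
  obtain ⟨a, b, P, hP, hcov⟩ := h
  refine ⟨a, b, P, hP, fun x => ?_⟩
  obtain ⟨y, hy, hxy⟩ := hcov x
  exact ⟨y, hy, hxy.trans (by exact_mod_cast hkl)⟩

end GraphBurning

theorem mainTheorem6 (k : ℕ) :
    ∃ N : ℕ, ∀ (V : Type*) [Fintype V] (T : SimpleGraph V),
      T.IsTree → GraphBurning.growth T ≤ k → N ≤ Fintype.card V →
        GraphBurning.burningNumber T ≤ ⌈Real.sqrt (Fintype.card V : ℝ)⌉₊ + 1 := by
  refine ⟨(1000 * (k + 1) ^ 4) ^ 2, fun V _ T hT hk hN => ?_⟩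
  have hspine : GraphBurning.HasSpine T (GraphBurning.growth T) :=
    Nat.sInf_mem (GraphBurning.exists_hasSpine T hT.connected)
  have hle := Nat.le_ceil (Real.sqrt (Fintype.card V : ℝ))
  have hcard : Fintype.card V ≤ ⌈Real.sqrt (Fintype.card V : ℝ)⌉₊ ^ 2 := by
    exact_mod_cast (Real.sqrt_le_left (by positivity)).1 hle
  refine GraphBurning.burningNumber_le_of_hasSpine (hspine.mono hk) ?_ ?_
  · exact ((Nat.pow_le_pow_iff_left two_ne_zero).1 (hN.trans hcard)).trans (Nat.le_succ _)
  -- For `m = s + 1` the required bound is exactly `n ≤ s ^ 2`.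
  · nlinarith
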